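/- Let $G$ be a finite group acting faithfully and $2$-transitively on a finite set $X$ with $|X|=n$. Call $g,h\in G$ intersecting if they agree at some point of $X$. For a group $H$ acting on $X$ let $\mathrm{Der}_H$ be its set of derangements (elements without fixed points), $d_H=|\mathrm{Der}_H|$, and let the derangement graph $\Gamma_H$ have vertex set $H$, two distinct elements being adjacent when they do not intersect. The eigenvalue of $\Gamma_H$ afforded by an irreducible complex character $\phi$ of $H$ is $\lambda_\phi=\frac1{\phi(1)}\sum_{d\in \mathrm{Der}_H}\phi(d)$. If $H$ is $2$-transitive, write its permutation character as $\chi_H=1_H+\psi_H$ with $\psi_H$ irreducible. The $\psi_G$-module is the image, in the space $\mathbb C^G$ of complex vectors indexed by $G$, of the $|G|\times|G|$ matrix $E_{\psi_G}$ with $(g,h)$-entry $\frac{\psi_G(1)}{|G|}\psi_G(hg^{-1})$. For $S\subseteq G$ let $v_S\in\mathbb C^G$ be its characteristic vector, and let $\mathbf 1$ be the all-ones vector. Let $K$ be a subgroup of $G$ that is minimal among the nonabelian normal subgroups of $G$. Assume that $K$ is $2$-transitive on $X$, that $-\frac{d_K}{n-1}$ is the least eigenvalue of the adjacency matrix of $\Gamma_K$,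 and that $\psi_K$ is the only irreducible character of $K$ affording this eigenvalue. Then for every maximum coclique (independent set of largest size) $S$ of $\Gamma_G$, the vector $v_S-\frac1n\mathbf 1$ lies in the $\psi_G$-module. Consequently $G$ has the EKR-module property: for every intersecting set $S\subseteq G$ of maximum size, $v_S$ is a linear combination of the vectors $v_{i,j}$ $(i,j\in X)$, where $v_{i,j}$ is the characteristic vector of $\{g\in G : g \text{ maps } i \text{ to } j\}$. -/

import Mathlib

namespace EKR

noncomputable section

/-- Two elements of `G` intersect if they agree at some point of `X`. -/
def Intersect (G X : Type*) [Group G] [MulAction G X] (g h : G) : Prop :=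
  ∃ x : X, g • x = h • x

/-- The derangement graph `Γ_G`: distinct elements are adjacent iff they do not intersect. -/
def derangementGraph (G X : Type*) [Group G] [MulAction G X] : SimpleGraph G where
  Adj g h := g ≠ h ∧ ¬ Intersect G X g h
  symm := ⟨fun _ _ hgh => ⟨hgh.1.symm, fun ⟨x, hx⟩ => hgh.2 ⟨x, hx.symm⟩⟩⟩
  loopless := ⟨fun _ hg => hg.1 rfl⟩

open Classical in
/-- The set `Der_G` of derangements: the elements without fixed points. -/
def derangementSet (G X : Type*) [Group G] [Fintype G] [MulAction G X] : Finset G :=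
  {g : G | ∀ x : X, g • x ≠ x}

/-- The permutation character `χ_G`: the number of fixed points. -/
def permChar (G X : Type*) [Group G] [MulAction G X] (g : G) : ℂ :=
  (Nat.card (MulAction.fixedBy X g) : ℂ)

/-- The character `ψ_G = χ_G - 1_G`. -/
def psi (G X : Type*) [Group G] [MulAction G X] (g : G) : ℂ :=
  permChar G X g - 1

/-- `φ` is the character of an irreducible finite-dimensional complex representation of `G`. -/
def IsIrreducibleCharacter (G : Type*) [Group G] (φ : G → ℂ) : Prop :=
  ∃ (m : ℕ) (ρ : Representation ℂ G (Fin m → ℂ)), ρ.IsIrreducible ∧ ρ.character = φ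

/-- The eigenvalue `λ_φ = (1 / φ(1)) ∑_{d ∈ Der_G} φ(d)` of `Γ_G` belonging to the character `φ`. -/
def charEigenvalue (G X : Type*) [Group G] [Fintype G] [MulAction G X] (φ : G → ℂ) : ℂ :=
  1 / φ 1 * ∑ d ∈ derangementSet G X, φ d

open Classical in
/-- The set of eigenvalues of the adjacency matrix `A(Γ_G)`. -/
def derangementEigenvalues (G X : Type*) [Group G] [Fintype G] [MulAction G X] : Set ℝ :=
  {μ : ℝ | Module.End.HasEigenvalue
    (Matrix.toLin' ((derangementGraph G X).adjMatrix ℝ)) μ}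

/-- The real number `-d_G / (n - 1)`, where `d_G = |Der_G|` and `n = |X|`. -/
def ratioValue (G X : Type*) [Group G] [Fintype G] [MulAction G X] [Fintype X] : ℝ :=
  -((derangementSet G X).card : ℝ) / ((Fintype.card X : ℝ) - 1)

/-- The matrix `E_φ`, with `(g, h)`-entry `(φ(1) / |G|) φ(h g⁻¹)`. -/
def idempotentMatrix (G : Type*) [Group G] [Fintype G] (φ : G → ℂ) : Matrix G G ℂ :=
  Matrix.of fun g h => φ 1 / (Fintype.card G : ℂ) * φ (h * g⁻¹)

/-- The `φ`-module: the image of `E_φ` acting on the vectors indexed by `G`. -/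
def charModule (G : Type*) [Group G] [Fintype G] (φ : G → ℂ) : Submodule ℂ (G → ℂ) :=
  LinearMap.range (idempotentMatrix G φ).mulVecLin

open Classical in
/-- The characteristic vector `v_S` of a set `S` of group elements. -/
def charVec {G : Type*} (S : Set G) : G → ℂ :=
  fun g => if g ∈ S then 1 else 0

/-- The canonical intersecting set `S_{i,j}` of the elements taking `i` to `j`. -/
def canonicalSet (G : Type*) {X : Type*} [Group G] [MulAction G X] (i j : X) : Set G :=
  {g : G | g • i = j}

/-- A set of pairwise intersecting elements. -/
def IsIntersecting (G X : Type*) [Group G] [MulAction G X] (S : Finset G) : Prop :=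
  ∀ g ∈ S, ∀ h ∈ S, Intersect G X g h

/-- The EKR-module property: the characteristic vector of each intersecting set of maximum size
is a linear combination of the characteristic vectors of the canonical intersecting sets. -/
def HasEKRModuleProperty (G X : Type*) [Group G] [MulAction G X] : Prop :=
  ∀ S : Finset G, IsIntersecting G X S →
    (∀ T : Finset G, IsIntersecting G X T → T.card ≤ S.card) →
    charVec (S : Set G) ∈
      Submodule.span ℂ {v : G → ℂ | ∃ i j : X, v = charVec (canonicalSet G i j)}

end

end EKR

/-!
Write `P_g` for the permutation matrix of `g`, and `⟨M, P_g⟩ = ∑ i, M i (g i)` (`pairing M g`) for a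
matrix `M` indexed by `X`. The functions `g ↦ ⟨M, P_g⟩` span the same space as the vectors
`v_{i,j}`, and those with `M` of zero row and column sums lie in the `ψ`-module. So it suffices to
write `v_S - 1/n` as a single such function on `G`, with `M` of zero row and column sums.

Within the 2-transitive group `K`, the ratio bound says that an intersecting set has at most `|K|/n`
elements, and that in the case of equality its characteristic vector minus `1/n` is an eigenvector
of `Γ_K` for the least eigenvalue `τ = -d_K/(n-1)`
(`card_le_and_exists_pairing_of_isIntersecting`). Such an eigenvector has the form `⟨M, P_k⟩`
(`exists_pairing_of_eigenvector`): what remains after subtracting its projection to the span of the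
`v_{i,j}` lies in a translation-invariant space of `τ`-eigenvectors orthogonal to all `v_{i,j}`. An
irreducible constituent of that space affords `τ`, hence has character `ψ_K`; but `∑ ψ_K(k) ρ(k)` is
zero on the space, and taking its trace gives `∑ ψ_K(k)² = 0`, which is absurd.

A maximum intersecting set `S` of `G` has `|G|/n` elements, so it meets every coset of `K` in exactly
`|K|/n` elements, and on each coset `gK` the function `f = v_S - 1/n` equals `⟨N_g, P_x⟩` for some
matrix `N_g` with zero row and column sums. To see that all `N_g` coincide
(`exists_pairing_of_card_eq`), let `D` be the set of derangements in `gK`. It is nonempty, since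
the number of fixed points on `gK` has mean and variance `1` (`exists_forall_apply_smul_ne`), and it is
normalised by `K`, so 2-transitivity gives `∑_{d ∈ D} P_d = |D|/(n-1) (J - I)`. As `S` contains no pair
`x, xd` with `d ∈ D`, the sum of `f(x) f(xd)` over `x ∈ K`, `d ∈ D` is known; expressed through the
matrices it determines the inner product of `N_1` and `N_g`, which turns out to be their common
squared norm. Therefore `N_g = N_1`.
-/

namespace EKR

noncomputable section

open MulAction

open scoped Classical

/-! ### Counting in transitive and 2-transitive groups -/

section Counting

variable {H X : Type*} [Group H] [Fintype H] [Fintype X] [MulAction H X]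

lemma card_mul_card_filter_smul_eq [IsPretransitive H X] (y y' : X) :
    Fintype.card X * (Finset.univ.filter fun h : H => h • y = y').card = Fintype.card H := by
  have key : ∀ z : X, (Finset.univ.filter fun h : H => h • y = z).card =
      (Finset.univ.filter fun h : H => h • y = y').card := by
    intro z
    obtain ⟨t, rfl⟩ := exists_smul_eq H z y'
    refine Finset.card_equiv (Equiv.mulLeft t) fun h => ?_
    simp [mul_smul]
  have := Finset.card_eq_sum_card_fiberwise (s := (Finset.univ : Finset H))
    (t := (Finset.univ : Finset X)) (f := fun h => h • y) (by simp)
  rw [Finset.sum_congr rfl fun z _ => key z] at this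
  simpa using this.symm

lemma card_mul_card_filter_smul_eq_and (h2 : IsMultiplyPretransitive H X 2)
    {i i' j j' : X} (hi : i ≠ i') (hj : j ≠ j') :
    Fintype.card X * (Fintype.card X - 1) *
      (Finset.univ.filter fun h : H => h • i = j ∧ h • i' = j').card = Fintype.card H := by
  have emb : ∀ {a b : X}, a ≠ b → Function.Injective ![a, b] := by
    intro a b hab
    simpa [Function.Injective, Fin.forall_fin_two, hab] using hab.symm
  have := card_mul_card_filter_smul_eq (H := H) (X := Fin 2 ↪ X) ⟨![i, i'], emb hi⟩
    ⟨![j, j'], emb hj⟩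
  rw [Fintype.card_embedding_eq] at this
  simpa [Nat.descFactorial, DFunLike.ext_iff, Fin.forall_fin_two, mul_comm] using this

end Counting

/-! ### Functions on the group given by matrices with zero row and column sums -/

section Pairing

variable {G X 𝕜 : Type*} [Group G] [Fintype X] [MulAction G X] [Field 𝕜]

/-- The function `g ↦ ⟨M, P_g⟩ = ∑ i, M i (g i)` on `G`, where `P_g` is the permutation matrix of
`g`. These functions are the linear combinations of the vectors `v_{i,j}`. -/
def pairing (M : X → X → 𝕜) (g : G) : 𝕜 := ∑ i, M i (g • i)

/-- All row sums and all column sums of `M` vanish. -/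
structure ZeroSums (M : X → X → 𝕜) : Prop where
  row : ∀ i, ∑ j, M i j = 0
  col : ∀ j, ∑ i, M i j = 0

/-- In a 2-transitive group, the sum of `⟨M, P_h⟩` over the coset `{h | h i = j}` recovers the entry
`M i j`: two distinct points are sent to two given distinct points by a constant number of
elements. -/
lemma sum_filter_pairing [CharZero 𝕜] [Nontrivial X] [Fintype G]
    (h2 : IsMultiplyPretransitive G X 2)
    {M : X → X → 𝕜} (hM : ZeroSums M) (i j : X) :
    ((Fintype.card X : 𝕜) - 1) * ∑ h : G with h • i = j, pairing M h =
      Fintype.card G * M i j := by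
  have hn : 1 < Fintype.card X := Fintype.one_lt_card
  have h0 : (Fintype.card X : 𝕜) ≠ 0 := by simp
  have hp : IsPretransitive G X := isPretransitive_of_is_two_pretransitive
  have e1 := congrArg (Nat.cast : ℕ → 𝕜) (card_mul_card_filter_smul_eq (H := G) i j)
  have expand : ∑ h : G with h • i = j, pairing M h = ∑ i', ∑ j', M i' j' *
      ((Finset.univ.filter fun h : G => h • i = j ∧ h • i' = j').card : 𝕜) := by
    simp only [pairing]
    rw [Finset.sum_comm]
    refine Finset.sum_congr rfl fun i' _ => ?_
    rw [← Finset.sum_fiberwise (s := Finset.univ.filter fun h : G => h • i = j)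
      (g := fun h => h • i')]
    refine Finset.sum_congr rfl fun j' _ => ?_
    rw [Finset.filter_filter, Finset.sum_congr rfl (g := fun _ => M i' j')]
    · simp [mul_comm]
    · intro h hh
      rw [(Finset.mem_filter.mp hh).2.2]
  -- the number of `h` with `h i = j` and `h i' = j'`, as a combination of Kronecker deltas
  have count : ∀ i' j', (Fintype.card X : 𝕜) * ((Fintype.card X : 𝕜) - 1) *
      ((Finset.univ.filter fun h : G => h • i = j ∧ h • i' = j').card : 𝕜) =
      Fintype.card G * (1 - (if i' = i then 1 else 0) - (if j' = j then 1 else 0) +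
        Fintype.card X * (if i' = i then if j' = j then 1 else 0 else 0)) := by
    intro i' j'
    by_cases hi : i' = i
    · subst hi
      by_cases hj : j' = j
      · subst hj
        push_cast at e1
        simp only [and_self, if_true]
        linear_combination ((Fintype.card X : 𝕜) - 1) * e1
      · have : (Finset.univ.filter fun h : G => h • i' = j ∧ h • i' = j') = ∅ := by
          ext h; simp; intro a b; exact hj (b.symm.trans a)
        simp [this, hj]
    · by_cases hj : j' = j
      · subst hj
        have : (Finset.univ.filter fun h : G => h • i = j' ∧ h • i' = j') = ∅ := by
          ext h; simp; intro a b; exact hi (smul_left_cancel h (b.trans a.symm))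
        simp [this, hi]
      · have := congrArg (Nat.cast : ℕ → 𝕜)
          (card_mul_card_filter_smul_eq_and h2 (Ne.symm hi) (Ne.symm hj))
        push_cast [Nat.cast_sub hn.le] at this
        simp [hi, hj, this]
  apply mul_left_cancel₀ h0
  rw [expand, ← mul_assoc, Finset.mul_sum]
  simp_rw [Finset.mul_sum]
  calc _ = ∑ i', ∑ j', M i' j' * (Fintype.card G * (1 - (if i' = i then 1 else 0) -
        (if j' = j then 1 else 0) +
        Fintype.card X * (if i' = i then if j' = j then 1 else 0 else 0))) := by
        refine Finset.sum_congr rfl fun i' _ => Finset.sum_congr rfl fun j' _ => ?_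
        rw [← count i' j']; ring
    _ = Fintype.card G * (∑ i', ∑ j', M i' j' - ∑ i', (if i' = i then ∑ j', M i' j' else 0)
        - ∑ i', ∑ j', (if j' = j then M i' j' else 0) + Fintype.card X *
          ∑ i', (if i' = i then ∑ j', (if j' = j then M i' j' else 0) else 0)) := by
        simp only [mul_add, mul_sub, Finset.mul_sum, ← Finset.sum_sub_distrib,
          ← Finset.sum_add_distrib]
        refine Finset.sum_congr rfl fun i' _ => ?_
        split_ifs with hi
        · simp only [Finset.mul_sum, ← Finset.sum_sub_distrib, ← Finset.sum_add_distrib]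
          refine Finset.sum_congr rfl fun j' _ => ?_
          split_ifs <;> ring
        · simp only [mul_zero, add_zero, sub_zero, ← Finset.sum_sub_distrib]
          refine Finset.sum_congr rfl fun j' _ => ?_
          split_ifs <;> ring
    _ = _ := by simp [hM.row, hM.col]; ring

/-- The functions `⟨M, P_h⟩` and `⟨N, P_h⟩` have, up to the factor `|G| / (n - 1)`, the inner product
of the matrices `M` and `N`. -/
lemma sum_pairing_mul_pairing [CharZero 𝕜] [Nontrivial X] [Fintype G]
    (h2 : IsMultiplyPretransitive G X 2)
    {M : X → X → 𝕜} (hM : ZeroSums M) (N : X → X → 𝕜) :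
    ((Fintype.card X : 𝕜) - 1) * ∑ h : G, pairing M h * pairing N h =
      Fintype.card G * ∑ i, ∑ j, M i j * N i j := by
  have : ∑ h : G, pairing M h * pairing N h =
      ∑ i, ∑ j, N i j * ∑ h : G with h • i = j, pairing M h := by
    conv_lhs => enter [2, h]; rw [pairing.eq_1 N, Finset.mul_sum]
    rw [Finset.sum_comm]
    refine Finset.sum_congr rfl fun i _ => ?_
    rw [← Finset.sum_fiberwise (s := Finset.univ) (g := fun h : G => h • i)]
    refine Finset.sum_congr rfl fun j _ => ?_
    rw [Finset.mul_sum]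
    refine Finset.sum_congr rfl fun h hh => ?_
    rw [(Finset.mem_filter.mp hh).2, mul_comm]
  rw [this]
  simp only [Finset.mul_sum (s := (Finset.univ : Finset X))]
  refine Finset.sum_congr rfl fun i _ => Finset.sum_congr rfl fun j _ => ?_
  linear_combination N i j * sum_filter_pairing h2 hM i j

lemma sum_pairing_eq_zero [CharZero 𝕜] [Nontrivial X] [Fintype G]
    {M : X → X → 𝕜} (hM : ZeroSums M) [IsPretransitive G X] : ∑ h : G, pairing M h = 0 := by
  simp only [pairing]
  rw [Finset.sum_comm]
  refine Finset.sum_eq_zero fun i _ => ?_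
  rw [← Finset.sum_fiberwise (s := Finset.univ) (g := fun h : G => h • i)]
  have : ∀ j, ∑ h : G with h • i = j, M i (h • i) =
      (Fintype.card G / Fintype.card X : 𝕜) * M i j := by
    intro j
    rw [Finset.sum_congr rfl (g := fun _ => M i j)]
    · have e1 := congrArg (Nat.cast : ℕ → 𝕜) (card_mul_card_filter_smul_eq (H := G) i j)
      push_cast at e1
      rw [← e1]
      simp
    · intro h hh
      rw [(Finset.mem_filter.mp hh).2]
  simp only [this, ← Finset.mul_sum, hM.row, mul_zero]

/-- Let `D` consist of derangements and be normalised by a 2-transitive set of group elements.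
Then `∑_{d ∈ D} P_d` is a multiple of `J - I`, by 2-transitivity. -/
lemma card_filter_of_derangements [Nontrivial X] {D : Finset G} (hD : ∀ d ∈ D, ∀ i : X, d • i ≠ i)
    (htr : ∀ i i' j j' : X, i ≠ i' → j ≠ j' →
      ∃ t : G, t • i = j ∧ t • i' = j' ∧ ∀ d ∈ D, t * d * t⁻¹ ∈ D) {i j : X} (hij : i ≠ j) :
    (Fintype.card X - 1) * (D.filter fun d => d • i = j).card = D.card := by
  have le : ∀ i i' j j' : X, i ≠ i' → j ≠ j' →
      (D.filter fun d => d • i = i').card ≤ (D.filter fun d => d • j = j').card := by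
    intro i i' j j' h h'
    obtain ⟨t, rfl, rfl, ht⟩ := htr i i' j j' h h'
    refine Finset.card_le_card_of_injOn (fun d => t * d * t⁻¹) ?_ ?_
    · intro d hd
      simp only [Finset.coe_filter, Set.mem_ofPred_eq] at hd ⊢
      refine ⟨ht d hd.1, ?_⟩
      simp [mul_smul, hd.2]
    · intro a _ b _ hab
      simpa using hab
  have := Finset.card_eq_sum_card_fiberwise (s := D)
    (t := Finset.univ.erase i) (f := fun d => d • i) (by
      intro d hd
      simpa using hD d hd i)
  rw [this, Finset.sum_congr rfl (g := fun _ => (D.filter fun d => d • i = j).card)]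
  · simp
  · intro k hk
    have hk' : i ≠ k := (Finset.ne_of_mem_erase hk).symm
    exact le_antisymm (le _ _ _ _ hk' hij) (le _ _ _ _ hij hk')

/-- Summing a function `⟨M, P_g⟩` over right translates by such a set `D` of derangements multiplies
it by `-|D| / (n - 1)`. -/
lemma sum_pairing_mul_derangements [CharZero 𝕜] [Nontrivial X] {D : Finset G}
    (hD : ∀ d ∈ D, ∀ i : X, d • i ≠ i)
    (htr : ∀ i i' j j' : X, i ≠ i' → j ≠ j' →
      ∃ t : G, t • i = j ∧ t • i' = j' ∧ ∀ d ∈ D, t * d * t⁻¹ ∈ D)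
    {M : X → X → 𝕜} (hM : ZeroSums M) (x : G) :
    ((Fintype.card X : 𝕜) - 1) * ∑ d ∈ D, pairing M (x * d) = -(D.card : 𝕜) * pairing M x := by
  have hn : 1 < Fintype.card X := Fintype.one_lt_card
  have row : ∀ i, ((Fintype.card X : 𝕜) - 1) * ∑ d ∈ D, M i ((x * d) • i) =
      -(D.card : 𝕜) * M i (x • i) := by
    intro i
    rw [← Finset.sum_fiberwise (s := D) (g := fun d => d • i), Finset.mul_sum]
    have : ∀ j, ((Fintype.card X : 𝕜) - 1) * ∑ d ∈ D with d • i = j, M i ((x * d) • i) =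
        D.card * (M i (x • j) - if j = i then M i (x • i) else 0) := by
      intro j
      rw [Finset.sum_congr rfl (g := fun _ => M i (x • j))]
      · by_cases hj : j = i
        · subst hj
          rw [Finset.filter_false_of_mem fun d hd => hD d hd j]
          simp
        · have := congrArg (Nat.cast : ℕ → 𝕜)
            (card_filter_of_derangements hD htr (Ne.symm hj))
          push_cast [Nat.cast_sub hn.le] at this
          simp [hj, ← this]
          ring
      · intro d hd
        rw [mul_smul, (Finset.mem_filter.mp hd).2]
    have shift : ∑ j, M i (x • j) = 0 :=
      (Equiv.sum_comp (MulAction.toPerm x) (fun j => M i j)).trans (hM.row i)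
    rw [Finset.sum_congr rfl fun j _ => this j, ← Finset.mul_sum, Finset.sum_sub_distrib, shift]
    simp
  simp only [pairing]
  rw [Finset.sum_comm, Finset.mul_sum, Finset.mul_sum]
  exact Finset.sum_congr rfl fun i _ => row i

end Pairing

/-! ### Irreducible constituents -/

/-- A nonzero subrepresentation contains an irreducible one, here transported to coordinates. -/
lemma exists_irreducible_of_ne_bot {H W : Type*} [Group H] [AddCommGroup W] [Module ℂ W]
    [FiniteDimensional ℂ W] (ρ : Representation ℂ H W) (U : Submodule ℂ W) (hU : U ≠ ⊥)
    (hinv : ∀ g, ∀ u ∈ U, ρ g u ∈ U) :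
    ∃ (m : ℕ) (σ : Representation ℂ H (Fin m → ℂ)) (T : (Fin m → ℂ) →ₗ[ℂ] W),
      σ.IsIrreducible ∧ Function.Injective T ∧ (∀ g v, T (σ g v) = ρ g (T v)) ∧
      ∀ v, T v ∈ U := by
  obtain ⟨V, ⟨hV0, hVU, hVinv⟩, hmin⟩ := WellFounded.has_min
    (wellFounded_lt : WellFounded ((· < ·) : Submodule ℂ W → Submodule ℂ W → Prop))
    {V | V ≠ ⊥ ∧ V ≤ U ∧ ∀ g, ∀ u ∈ V, ρ g u ∈ V} ⟨U, hU, le_rfl, hinv⟩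
  let e := (Module.finBasis ℂ V).equivFun
  let r := (⟨V, hVinv⟩ : Subrepresentation ρ).toRepresentation
  let σ : Representation ℂ H (Fin (Module.finrank ℂ V) → ℂ) :=
    { toFun := fun g => e.toLinearMap ∘ₗ r g ∘ₗ e.symm.toLinearMap
      map_one' := by ext; simp
      map_mul' := by intro a b; apply LinearMap.ext; intro v; simp }
  let T : (Fin (Module.finrank ℂ V) → ℂ) →ₗ[ℂ] W := V.subtype ∘ₗ e.symm.toLinearMap
  have hT : Function.Injective T := V.injective_subtype.comp e.symm.injective
  have hTσ : ∀ g v, T (σ g v) = ρ g (T v) := by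
    intro g v
    simp only [T, σ, MonoidHom.coe_mk, OneHom.coe_mk, LinearMap.comp_apply, LinearEquiv.coe_coe,
      LinearEquiv.symm_apply_apply]
    rfl
  have hTr : LinearMap.range T = V := by
    simp [T, LinearMap.range_comp]
  refine ⟨_, σ, T, ?_, hT, hTσ, fun v => hVU (e.symm v).2⟩
  have cases : ∀ P : Subrepresentation σ, P.toSubmodule = ⊥ ∨ P.toSubmodule = ⊤ := by
    intro P
    by_contra! h
    have hPV : P.toSubmodule.map T ≤ V := LinearMap.map_le_range.trans hTr.le
    refine hmin (P.toSubmodule.map T) ⟨?_, hPV.trans hVU, ?_⟩ (lt_of_le_of_ne hPV ?_)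
    · intro h'
      refine h.1 ((Submodule.eq_bot_iff _).mpr fun p hp => hT ?_)
      rw [map_zero]
      exact (Submodule.eq_bot_iff _).mp h' _ (Submodule.mem_map_of_mem hp)
    · rintro g _ ⟨p, hp, rfl⟩
      exact ⟨σ g p, P.apply_mem_toSubmodule g hp, hTσ g p⟩
    · intro h'
      refine h.2 (eq_top_iff.mpr fun v _ => ?_)
      have hv : T v ∈ P.toSubmodule.map T := h'.symm ▸ (e.symm v).2
      obtain ⟨p, hp, hpv⟩ := hv
      exact hT hpv ▸ hp
  exact
    { exists_pair_ne := ⟨⊥, ⊤, fun h => hV0 <| by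
        rw [← hTr, LinearMap.range_eq_bot]
        apply LinearMap.ext
        intro v
        have hv : v ∈ (⊤ : Subrepresentation σ).toSubmodule := Submodule.mem_top (R := ℂ)
        rw [← h] at hv
        rw [(Submodule.mem_bot ℂ).mp hv]
        simp⟩
      eq_bot_or_eq_top := fun P => (cases P).imp
        (fun h => Subrepresentation.toSubmodule_injective h)
        (fun h => Subrepresentation.toSubmodule_injective h) }

/-- If `∑ c_k ρ(k)` acts on an invariant subspace as a scalar, then the trace of this scalar on an
irreducible constituent computes `∑ c_k φ(k)` for its character `φ`. -/
lemma exists_irreducibleCharacter {H W : Type*} [Group H] [AddCommGroup W] [Module ℂ W]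
    [FiniteDimensional ℂ W] (ρ : Representation ℂ H W) (U : Submodule ℂ W) (hU : U ≠ ⊥)
    (hinv : ∀ g, ∀ u ∈ U, ρ g u ∈ U) :
    ∃ φ : H → ℂ, IsIrreducibleCharacter H φ ∧ φ 1 ≠ 0 ∧
      ∀ (D : Finset H) (c : H → ℂ) (s : ℂ), (∀ u ∈ U, ∑ d ∈ D, c d • ρ d u = s • u) →
        ∑ d ∈ D, c d * φ d = s * φ 1 := by
  obtain ⟨m, σ, T, hσ, hT, hTσ, hTU⟩ := exists_irreducible_of_ne_bot ρ U hU hinv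
  refine ⟨σ.character, ⟨m, σ, hσ, rfl⟩, ?_, ?_⟩
  · rw [Representation.char_one]
    have : Nontrivial (Fin m → ℂ) := by
      by_contra h
      rw [not_nontrivial_iff_subsingleton] at h
      have hb : (⊥ : Subrepresentation σ) ≠ ⊤ := bot_ne_top
      exact hb (SetLike.ext fun v => by
        rw [Subsingleton.elim v 0]
        exact iff_of_true (Submodule.zero_mem (⊥ : Subrepresentation σ).toSubmodule)
          (Submodule.zero_mem (⊤ : Subrepresentation σ).toSubmodule))
    exact_mod_cast (Module.finrank_pos (R := ℂ) (M := Fin m → ℂ)).ne'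
  · intro D c s h
    have hs : ∑ d ∈ D, c d • σ d = s • (LinearMap.id : (Fin m → ℂ) →ₗ[ℂ] _) := by
      apply LinearMap.ext
      intro v
      apply hT
      simpa [hTσ] using h (T v) (hTU v)
    have := congrArg (LinearMap.trace ℂ (Fin m → ℂ)) hs
    rw [Representation.char_one]
    simpa [Representation.character] using this

/-! ### Eigenvectors of the derangement graph for the ratio value -/

section Eigen

variable {H X : Type*} [Group H] [Fintype H] [Fintype X] [MulAction H X]

/-- The right regular representation `(g f)(x) = f (x g)` on complex functions. -/
def rightTranslation (H : Type*) [Group H] : Representation ℂ H (H → ℂ) where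
  toFun g := LinearMap.funLeft ℂ ℂ (· * g)
  map_one' := by ext; simp
  map_mul' a b := by apply LinearMap.ext; intro f; funext x; simp [LinearMap.funLeft, mul_assoc]

@[simp]
lemma rightTranslation_apply {H : Type*} [Group H] (g : H) (f : H → ℂ) (x : H) :
    rightTranslation H g f x = f (x * g) := rfl

lemma mem_derangementSet {g : H} : g ∈ derangementSet H X ↔ ∀ x : X, g • x ≠ x := by
  simp [derangementSet]

lemma conj_mem_derangementSet (t : H) {d : H} (hd : d ∈ derangementSet H X) :
    t * d * t⁻¹ ∈ derangementSet H X := by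
  rw [mem_derangementSet] at hd ⊢
  intro x hx
  apply hd (t⁻¹ • x)
  rw [eq_inv_smul_iff, ← mul_smul, ← mul_smul]
  exact hx

/-- The number of fixed points of `h * g⁻¹` is the number of points at which `h` and `g` agree. -/
lemma psi_mul_inv {H X : Type*} [Group H] [Fintype X] [MulAction H X] (h g : H) :
    psi H X (h * g⁻¹) = ∑ l : X, (if h • l = g • l then 1 else 0) - 1 := by
  rw [psi, permChar, Finset.sum_boole, Nat.card_eq_fintype_card]
  congr 2
  rw [Fintype.card_subtype]
  refine (Finset.card_equiv (MulAction.toPerm g) fun l => ?_).symm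
  simp [mul_smul]

/-- Correlating `u` with `ψ` sums `u` over the sets `{h | h l = g l}`. -/
lemma sum_psi_mul (u : H → ℂ) (g : H) :
    ∑ h : H, psi H X (h * g⁻¹) * u h =
      ∑ l : X, ∑ h : H with h • l = g • l, u h - ∑ h : H, u h := by
  simp only [psi_mul_inv, sub_mul, Finset.sum_mul, Finset.sum_sub_distrib, one_mul]
  rw [Finset.sum_comm]
  simp [Finset.sum_filter]

lemma sum_fiberwise_row {𝕜 : Type*} [AddCommMonoid 𝕜] (f : H → 𝕜) (i : X) :
    ∑ j, ∑ h : H with h • i = j, f h = ∑ h, f h :=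
  Finset.sum_fiberwise (s := Finset.univ) (g := fun h : H => h • i) f

lemma sum_fiberwise_col {𝕜 : Type*} [AddCommMonoid 𝕜] (f : H → 𝕜) (j : X) :
    ∑ i, ∑ h : H with h • i = j, f h = ∑ h, f h := by
  rw [← Finset.sum_fiberwise (s := Finset.univ) (g := fun h : H => h⁻¹ • j) f]
  refine Finset.sum_congr rfl fun i _ => Finset.sum_congr ?_ fun _ _ => rfl
  ext h
  simp [inv_smul_eq_iff, eq_comm (a := j)]

/-- If `ψ` is the only irreducible character affording the ratio value, then an eigenfunction for
that value which sums to zero over every set `{h | h i = j}` vanishes: the space `U` of such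
functions is translation invariant, an irreducible constituent has character `ψ`, and
`∑ ψ(h) ρ(h)` annihilates `U`, so `∑ ψ(h)²` would be zero. -/
lemma eq_zero_of_eigenvector [Nonempty X]
    (hunique : ∀ φ : H → ℂ, IsIrreducibleCharacter H φ →
      (charEigenvalue H X φ = (ratioValue H X : ℂ) ↔ φ = psi H X))
    (u : H → ℂ) (hu : ∀ x, ∑ d ∈ derangementSet H X, u (x * d) = (ratioValue H X : ℂ) * u x)
    (hu0 : ∀ i j : X, ∑ h : H with h • i = j, u h = 0) : u = 0 := by
  let U : Submodule ℂ (H → ℂ) :=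
    { carrier := {u | (∀ x, ∑ d ∈ derangementSet H X, u (x * d) = (ratioValue H X : ℂ) * u x) ∧
        ∀ i j : X, ∑ h : H with h • i = j, u h = 0}
      zero_mem' := by simp
      add_mem' := by
        rintro a b ⟨ha, ha'⟩ ⟨hb, hb'⟩
        refine ⟨fun x => ?_, fun i j => ?_⟩
        · simp [Finset.sum_add_distrib, ha, hb, mul_add]
        · simp [Finset.sum_add_distrib, ha', hb']
      smul_mem' := by
        rintro c a ⟨ha, ha'⟩
        refine ⟨fun x => ?_, fun i j => ?_⟩
        · simp [← Finset.mul_sum, ha, mul_left_comm]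
        · simp [← Finset.mul_sum, ha'] }
  by_contra hne
  have hU : U ≠ ⊥ := fun h => hne ((Submodule.eq_bot_iff U).mp h u ⟨hu, hu0⟩)
  have hinv : ∀ g, ∀ v ∈ U, rightTranslation H g v ∈ U := by
    rintro g v ⟨hv, hv0⟩
    refine ⟨fun x => ?_, fun i j => ?_⟩
    · rw [rightTranslation_apply, ← hv (x * g)]
      refine Finset.sum_bij' (fun d _ => g⁻¹ * d * g) (fun d _ => g * d * g⁻¹) ?_ ?_ ?_ ?_ ?_
      · intro d hd
        simpa using conj_mem_derangementSet g⁻¹ hd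
      · intro d hd
        exact conj_mem_derangementSet g hd
      · intro d _; group
      · intro d _; group
      · intro d _
        rw [rightTranslation_apply]
        congr 1
        group
    · rw [← hv0 (g⁻¹ • i) j]
      refine Finset.sum_equiv (Equiv.mulRight g) (fun h => ?_) fun h _ => rfl
      simp [mul_smul]
  obtain ⟨φ, hφ, hφ1, htrace⟩ := exists_irreducibleCharacter (rightTranslation H) U hU hinv
  have hφψ : φ = psi H X := by
    rw [← hunique φ hφ, charEigenvalue]
    have := htrace (derangementSet H X) (fun _ => 1) (ratioValue H X) (by
      rintro v ⟨hv, -⟩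
      funext x
      simpa [Finset.sum_apply] using hv x)
    simp only [one_mul] at this
    rw [this]
    field_simp
  have hsq := htrace Finset.univ (psi H X) 0 (by
    rintro v ⟨-, hv0⟩
    funext x
    have hsum : ∑ h, v h = 0 := by
      obtain ⟨i⟩ := ‹Nonempty X›
      rw [← sum_fiberwise_row v i]
      exact Finset.sum_eq_zero fun j _ => hv0 i j
    -- on `U` the operator `∑ ψ(h) ρ(h)` is convolution with `ψ`
    have := sum_psi_mul (X := X) (fun h => v (x * h)) 1
    simp only [inv_one, mul_one, one_smul] at this
    have hshift : ∑ h, v (x * h) = ∑ h, v h := Equiv.sum_comp (Equiv.mulLeft x) v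
    rw [hshift, hsum, sub_zero] at this
    rw [zero_smul, Finset.sum_apply]
    refine this.trans (Finset.sum_eq_zero fun l _ => ?_)
    rw [← hv0 l (x • l)]
    refine Finset.sum_equiv (Equiv.mulLeft x) (fun h => ?_) fun h _ => rfl
    simp [mul_smul])
  have hreal : ∀ h, psi H X h = (((Nat.card (fixedBy X h) : ℝ) - 1 : ℝ) : ℂ) := by
    intro h
    simp [psi, permChar]
  rw [zero_mul, hφψ] at hsq
  simp only [hreal, ← Complex.ofReal_mul, ← Complex.ofReal_sum, Complex.ofReal_eq_zero] at hsq
  rw [Finset.sum_eq_zero_iff_of_nonneg fun h _ => mul_self_nonneg _] at hsq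
  apply hφ1
  rw [hφψ, hreal, mul_self_eq_zero.mp (hsq 1 (Finset.mem_univ 1))]
  simp

/-- Under the uniqueness hypothesis, the sum-zero eigenfunctions for the ratio value are the
functions `⟨M, P_h⟩` with `M` of zero row and column sums. -/
lemma exists_pairing_of_eigenvector [Nontrivial X] (h2 : IsMultiplyPretransitive H X 2)
    (hunique : ∀ φ : H → ℂ, IsIrreducibleCharacter H φ →
      (charEigenvalue H X φ = (ratioValue H X : ℂ) ↔ φ = psi H X))
    (f : H → ℝ) (hf : ∀ x, ∑ d ∈ derangementSet H X, f (x * d) = ratioValue H X * f x)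
    (hf0 : ∑ h, f h = 0) : ∃ M : X → X → ℝ, ZeroSums M ∧ ∀ h, f h = pairing M h := by
  have hn : (0 : ℝ) < (Fintype.card X : ℝ) - 1 := by
    have : 1 < Fintype.card X := Fintype.one_lt_card
    rw [sub_pos]; exact_mod_cast this
  have hH : (Fintype.card H : ℝ) ≠ 0 := by simp
  -- the orthogonal projection of `f` onto the span of the `v_{i,j}`
  let M : X → X → ℝ := fun i j =>
    ((Fintype.card X : ℝ) - 1) / Fintype.card H * ∑ h : H with h • i = j, f h
  have hM : ZeroSums M :=
    ⟨fun i => by simp only [M, ← Finset.mul_sum, sum_fiberwise_row, hf0, mul_zero],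
      fun j => by simp only [M, ← Finset.mul_sum, sum_fiberwise_col, hf0, mul_zero]⟩
  refine ⟨M, hM, fun h => ?_⟩
  have hzero := eq_zero_of_eigenvector hunique (fun h => ((f h - pairing M h : ℝ) : ℂ)) (by
    intro x
    have e := sum_pairing_mul_derangements (D := derangementSet H X)
      (fun d hd => mem_derangementSet.mp hd) (fun i i' j j' hi hj => by
        obtain ⟨t, h, h'⟩ := is_two_pretransitive_iff.mp h2 hi hj
        exact ⟨t, h, h', fun d hd => conj_mem_derangementSet t hd⟩) hM x
    have e' : ∑ d ∈ derangementSet H X, pairing M (x * d) = ratioValue H X * pairing M x := by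
      rw [ratioValue]
      field_simp
      linear_combination e
    norm_cast
    rw [Finset.sum_sub_distrib, hf, e', mul_sub]) (by
    intro i j
    norm_cast
    rw [Finset.sum_sub_distrib, sub_eq_zero]
    have e := sum_filter_pairing h2 hM i j
    apply mul_left_cancel₀ hn.ne'
    rw [e]
    simp only [M]
    field_simp)
  have := congrFun hzero h
  simp only [Pi.zero_apply, Complex.ofReal_eq_zero] at this
  exact sub_eq_zero.mp this

lemma derangementGraph_adj_mul [Nonempty X] (x d : H) :
    (derangementGraph H X).Adj x (x * d) ↔ d ∈ derangementSet H X := by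
  obtain ⟨i⟩ := ‹Nonempty X›
  rw [mem_derangementSet]
  constructor
  · rintro ⟨-, h⟩ l hl
    exact h ⟨l, by rw [mul_smul, hl]⟩
  · intro h
    refine ⟨fun hx => h i ?_, fun ⟨l, hl⟩ => h l ?_⟩
    · rw [left_eq_mul.mp hx, one_smul]
    · rw [mul_smul] at hl
      exact (smul_left_cancel x hl).symm

lemma adjMatrix_derangementGraph_mulVec [Nonempty X] (v : H → ℝ) (x : H) :
    ((derangementGraph H X).adjMatrix ℝ).mulVec v x = ∑ d ∈ derangementSet H X, v (x * d) := by
  rw [Matrix.mulVec, dotProduct, ← Equiv.sum_comp (Equiv.mulLeft x)]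
  simp only [Equiv.coe_mulLeft, SimpleGraph.adjMatrix_apply, derangementGraph_adj_mul, ite_mul,
    one_mul, zero_mul, Finset.sum_ite_mem, Finset.univ_inter]

/-- A symmetric real matrix minus a lower bound of its eigenvalues is positive semidefinite. -/
lemma posSemidef_sub_of_mem_lowerBounds {ι : Type*} [Fintype ι] {A : Matrix ι ι ℝ}
    (hA : A.IsHermitian) {τ : ℝ}
    (hτ : τ ∈ lowerBounds {μ : ℝ | Module.End.HasEigenvalue (Matrix.toLin' A) μ}) :
    (A - τ • (1 : Matrix ι ι ℝ)).PosSemidef := by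
  have hB : (A - τ • (1 : Matrix ι ι ℝ)).IsHermitian :=
    hA.sub (by simp [Matrix.IsHermitian])
  rw [hB.posSemidef_iff_eigenvalues_nonneg]
  intro i
  have hv := hB.mulVec_eigenvectorBasis i
  have hne : (hB.eigenvectorBasis i : ι → ℝ) ≠ 0 := by
    intro h
    apply hB.eigenvectorBasis.toBasis.ne_zero i
    ext k
    simpa using congrFun h k
  have : τ ≤ hB.eigenvalues i + τ := by
    refine hτ (Module.End.hasEigenvalue_of_hasEigenvector (x := (hB.eigenvectorBasis i : ι → ℝ))
      ⟨Module.End.mem_eigenspace_iff.mpr ?_, hne⟩)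
    rw [Matrix.sub_mulVec, Matrix.smul_mulVec, Matrix.one_mulVec, sub_eq_iff_eq_add] at hv
    rw [Matrix.toLin'_apply, hv, add_smul]
  simpa using this

/-- Composing any permutation `π` with a 2-transitive group produces a derangement: the number of
fixed points of `π ∘ h` has mean `1` and variance `1`, so it cannot always be positive. -/
lemma exists_forall_apply_smul_ne [Nontrivial X] (h2 : IsMultiplyPretransitive H X 2)
    (π : Equiv.Perm X) : ∃ h : H, ∀ x, π (h • x) ≠ x := by
  by_contra! hno
  have hn : 1 < Fintype.card X := Fintype.one_lt_card
  have hn' : (0 : ℝ) < (Fintype.card X : ℝ) - 1 := by rw [sub_pos]; exact_mod_cast hn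
  have hX : (Fintype.card X : ℝ) ≠ 0 := by simp
  have hp : IsPretransitive H X := isPretransitive_of_is_two_pretransitive
  let N : X → X → ℝ := fun i j => if π j = i then 1 else 0
  let M : X → X → ℝ := fun i j => N i j - 1 / Fintype.card X
  have hrow : ∀ i, ∑ j, N i j = 1 := by
    intro i
    simp only [N, ← Equiv.eq_symm_apply π]
    simp
  have hM : ZeroSums M := by
    refine ⟨fun i => ?_, fun j => ?_⟩
    · simp only [M, Finset.sum_sub_distrib, hrow]
      simp
    · simp [M, N, Finset.sum_sub_distrib]
  have hMN : ∀ h : H, pairing M h = pairing N h - 1 := by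
    intro h
    simp [pairing, M, Finset.sum_sub_distrib]
  have hpos : ∀ h : H, 0 ≤ pairing M h := by
    intro h
    obtain ⟨x, hx⟩ := hno h
    have : N x (h • x) ≤ pairing N h := Finset.single_le_sum (f := fun i => N i (h • i))
      (fun i _ => by simp only [N]; split_ifs <;> norm_num) (Finset.mem_univ x)
    simp only [N, hx, if_true] at this
    rw [hMN]
    linarith
  have hzero : ∀ h : H, pairing M h = 0 := fun h =>
    (Finset.sum_eq_zero_iff_of_nonneg fun h _ => hpos h).mp (sum_pairing_eq_zero hM) h
      (Finset.mem_univ h)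
  have hsq := sum_pairing_mul_pairing h2 hM N
  have hval : ∑ i, ∑ j, M i j * N i j = Fintype.card X - 1 := by
    have : ∀ i j, M i j * N i j = (1 - 1 / Fintype.card X) * N i j := by
      intro i j
      simp only [M, N]
      split_ifs <;> ring
    simp only [this, ← Finset.mul_sum, hrow]
    simp only [Finset.sum_const, Finset.card_univ, nsmul_eq_mul, mul_one]
    field_simp
  simp only [hzero, zero_mul, Finset.sum_const_zero, mul_zero, hval] at hsq
  have hH : (0 : ℝ) < Fintype.card H := by exact_mod_cast Fintype.card_pos
  exact (mul_pos hH hn').ne hsq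

/-- The ratio bound for intersecting sets of a 2-transitive group whose least eigenvalue is the
ratio value, with the shape of the characteristic vector in case of equality. -/
lemma card_le_and_exists_pairing_of_isIntersecting [Nontrivial X]
    (h2 : IsMultiplyPretransitive H X 2)
    (hleast : IsLeast (derangementEigenvalues H X) (ratioValue H X))
    (hunique : ∀ φ : H → ℂ, IsIrreducibleCharacter H φ →
      (charEigenvalue H X φ = (ratioValue H X : ℂ) ↔ φ = psi H X))
    {T : Finset H} (hT : IsIntersecting H X T) :
    (Fintype.card X : ℝ) * T.card ≤ Fintype.card H ∧
      ((Fintype.card X : ℝ) * T.card = Fintype.card H →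
        ∃ M : X → X → ℝ, ZeroSums M ∧
          ∀ h, (if h ∈ T then 1 else 0) - 1 / (Fintype.card X : ℝ) = pairing M h) := by
  have hn : 1 < Fintype.card X := Fintype.one_lt_card
  have hn' : (0 : ℝ) < (Fintype.card X : ℝ) - 1 := by rw [sub_pos]; exact_mod_cast hn
  have hX : (0 : ℝ) < Fintype.card X := by linarith
  have hH : (0 : ℝ) < Fintype.card H := by exact_mod_cast Fintype.card_pos
  have hDpos : (0 : ℝ) < (derangementSet H X).card := by
    obtain ⟨h, hh⟩ := exists_forall_apply_smul_ne h2 (Equiv.refl X)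
    exact_mod_cast Finset.card_pos.mpr ⟨h, mem_derangementSet.mpr hh⟩
  set n : ℝ := (Fintype.card X : ℝ) with hn_def
  set D : ℝ := ((derangementSet H X).card : ℝ) with hD_def
  set N : ℝ := (Fintype.card H : ℝ) with hN_def
  set t : ℝ := (T.card : ℝ) with ht_def
  have hτ : ratioValue H X = -D / (n - 1) := rfl
  let v : H → ℝ := fun h => if h ∈ T then 1 else 0
  let f : H → ℝ := fun h => v h - t / N
  have hv : ∑ h, v h = t := by simp [v, ht_def]
  have hvv : ∑ h, v h * v h = t := by simp [v, ht_def]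
  have hindep : ∀ x, ∀ d ∈ derangementSet H X, v x * v (x * d) = 0 := by
    intro x d hd
    by_contra hne
    have hx : x ∈ T ∧ x * d ∈ T := by
      simpa [v, and_comm] using hne
    obtain ⟨l, hl⟩ := hT x hx.1 _ hx.2
    rw [mul_smul] at hl
    exact mem_derangementSet.mp hd l (smul_left_cancel x hl).symm
  have hshift : ∀ d, ∑ x, v (x * d) = t := fun d =>
    (Equiv.sum_comp (Equiv.mulRight d) v).trans hv
  have hf0 : ∑ h, f h = 0 := by
    simp only [f, Finset.sum_sub_distrib, hv, Finset.sum_const, Finset.card_univ, nsmul_eq_mul]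
    rw [← hN_def]
    field_simp
    ring
  have hff : ∑ h, f h * f h = t - t * t / N := by
    have : ∀ h, f h * f h = v h * v h - 2 * (t / N) * v h + (t / N) ^ 2 := by
      intro h; simp only [f]; ring
    simp only [this, Finset.sum_add_distrib, Finset.sum_sub_distrib, ← Finset.mul_sum, hv, hvv,
      Finset.sum_const, Finset.card_univ, nsmul_eq_mul]
    rw [← hN_def]
    field_simp
    ring
  have hfAf : ∑ x, f x * ∑ d ∈ derangementSet H X, f (x * d) = -(D * t * t / N) := by
    have : ∀ x, f x * ∑ d ∈ derangementSet H X, f (x * d) =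
        ∑ d ∈ derangementSet H X, (-(t / N) * v x - t / N * v (x * d) + (t / N) ^ 2) := by
      intro x
      rw [Finset.mul_sum]
      refine Finset.sum_congr rfl fun d hd => ?_
      simp only [f]
      linear_combination hindep x d hd
    simp only [this]
    rw [Finset.sum_comm]
    simp only [Finset.sum_add_distrib, Finset.sum_sub_distrib, ← Finset.mul_sum, hv, hshift,
      Finset.sum_const, Finset.card_univ, nsmul_eq_mul]
    rw [← hN_def, ← hD_def]
    field_simp
    ring
  have hpsd := posSemidef_sub_of_mem_lowerBounds (A := (derangementGraph H X).adjMatrix ℝ)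
    (by
      rw [Matrix.IsHermitian, Matrix.conjTranspose_eq_transpose_of_trivial]
      exact SimpleGraph.isSymm_adjMatrix _) hleast.2
  have hmul : ∀ x, (((derangementGraph H X).adjMatrix ℝ -
      ratioValue H X • (1 : Matrix H H ℝ)).mulVec f) x =
      ∑ d ∈ derangementSet H X, f (x * d) - ratioValue H X * f x := by
    intro x
    rw [Matrix.sub_mulVec, Matrix.smul_mulVec, Matrix.one_mulVec, Pi.sub_apply,
      adjMatrix_derangementGraph_mulVec]
    rfl
  have hform : star f ⬝ᵥ (((derangementGraph H X).adjMatrix ℝ -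
      ratioValue H X • (1 : Matrix H H ℝ)).mulVec f) = D * t * (N - n * t) / (N * (n - 1)) := by
    have : ∀ x, star f x * (((derangementGraph H X).adjMatrix ℝ -
      ratioValue H X • (1 : Matrix H H ℝ)).mulVec f) x =
      f x * ∑ d ∈ derangementSet H X, f (x * d) - ratioValue H X * (f x * f x) := by
      intro x
      rw [hmul]
      simp only [Pi.star_apply, star_trivial]
      ring
    rw [dotProduct]
    rw [Finset.sum_congr rfl fun x _ => this x, Finset.sum_sub_distrib, ← Finset.mul_sum, hfAf, hff,
      hτ]
    field_simp
    ring
  constructor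
  · rcases (Nat.cast_nonneg T.card : (0 : ℝ) ≤ t).eq_or_lt with h0 | ht
    · have : n * t = 0 := by rw [ht_def, ← h0, mul_zero]
      exact this.trans_le hH.le
    · have h := hpsd.dotProduct_mulVec_nonneg f
      rw [hform] at h
      by_contra! hlt
      refine absurd h (not_le.mpr (div_neg_of_neg_of_pos ?_ (mul_pos hH hn')))
      exact mul_neg_of_pos_of_neg (mul_pos hDpos ht) (by linarith)
  · intro heq
    have hker : ((derangementGraph H X).adjMatrix ℝ -
        ratioValue H X • (1 : Matrix H H ℝ)).mulVec f = 0 := by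
      rw [← hpsd.dotProduct_mulVec_zero_iff, hform, heq]
      simp
    obtain ⟨M, hM, hfM⟩ := exists_pairing_of_eigenvector h2 hunique f (fun x => by
      have := congrFun hker x
      rw [hmul] at this
      exact sub_eq_zero.mp this) hf0
    refine ⟨M, hM, fun h => ?_⟩
    rw [← hfM h]
    simp only [f, v]
    congr 1
    rw [← heq]
    have ht : t ≠ 0 := by
      intro h0
      rw [h0, mul_zero] at heq
      exact hH.ne heq
    field_simp

end Eigen

/-! ### Gluing over the cosets of a 2-transitive normal subgroup -/

section Gluing

variable {G X : Type*} [Group G] [Fintype G] [Fintype X] [MulAction G X]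

lemma ZeroSums.smul_right {𝕜 : Type*} [Field 𝕜] {G X : Type*} [Group G] [Fintype X]
    [MulAction G X] {M : X → X → 𝕜} (hM : ZeroSums M) (g : G) :
    ZeroSums fun i j => M i (g • j) :=
  ⟨fun i => (Equiv.sum_comp (MulAction.toPerm g) (M i)).trans (hM.row i), fun j => hM.col (g • j)⟩

/-- Each coset of `K` is counted `|K|` times when `g K` runs over all `g`. -/
lemma sum_card_filter_mul_mem {G : Type*} [Group G] [Fintype G] (K : Subgroup G) [Fintype K]
    (S : Finset G) :
    ∑ g : G, (Finset.univ.filter fun k : K => g * k ∈ S).card = Fintype.card K * S.card := by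
  simp only [Finset.card_filter]
  rw [Finset.sum_comm]
  have : ∀ k : K, ∑ g : G, (if g * k ∈ S then 1 else 0) = S.card := by
    intro k
    refine (Equiv.sum_comp (Equiv.mulRight (k : G)) (fun g => if g ∈ S then 1 else 0)).trans ?_
    simp
  simp [this]

lemma isIntersecting_filter_mul_mem {G X : Type*} [Group G] [MulAction G X] (K : Subgroup G)
    [Fintype K] {S : Finset G} (hS : IsIntersecting G X S) (g : G) :
    IsIntersecting K X (Finset.univ.filter fun k : K => g * k ∈ S) := by
  intro a ha b hb
  obtain ⟨x, hx⟩ := hS _ (Finset.mem_filter.mp ha).2 _ (Finset.mem_filter.mp hb).2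
  rw [mul_smul, mul_smul] at hx
  exact ⟨x, smul_left_cancel g hx⟩

variable [Nontrivial X] (K : Subgroup G) [Fintype K]

/-- An intersecting set of size `|G| / n` meets every coset of `K` in `|K| / n` elements, and no
intersecting set is larger. -/
lemma card_le_and_card_coset
    (hK : IsMultiplyPretransitive K X 2)
    (hleast : IsLeast (derangementEigenvalues K X) (ratioValue K X))
    (hunique : ∀ φ : K → ℂ, IsIrreducibleCharacter K φ →
      (charEigenvalue K X φ = (ratioValue K X : ℂ) ↔ φ = psi K X))
    {S : Finset G} (hS : IsIntersecting G X S) :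
    Fintype.card X * S.card ≤ Fintype.card G ∧
      (Fintype.card X * S.card = Fintype.card G → ∀ g : G,
        Fintype.card X * (Finset.univ.filter fun k : K => g * k ∈ S).card = Fintype.card K) := by
  have hle : ∀ g : G, Fintype.card X * (Finset.univ.filter fun k : K => g * k ∈ S).card ≤
      Fintype.card K := fun g => by
    exact_mod_cast (card_le_and_exists_pairing_of_isIntersecting hK hleast hunique
      (isIntersecting_filter_mul_mem K hS g)).1
  have hsum : ∑ g : G, Fintype.card X * (Finset.univ.filter fun k : K => g * k ∈ S).card =
      Fintype.card K * (Fintype.card X * S.card) := by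
    rw [← Finset.mul_sum, sum_card_filter_mul_mem]
    ring
  have hconst : ∑ _g : G, Fintype.card K = Fintype.card K * Fintype.card G := by
    simp [mul_comm]
  constructor
  · refine Nat.le_of_mul_le_mul_left ?_ (Fintype.card_pos (α := K))
    rw [← hsum, ← hconst]
    exact Finset.sum_le_sum fun g _ => hle g
  · intro h g
    exact (Finset.sum_eq_sum_iff_of_le fun g _ => hle g).mp (by rw [hsum, hconst, h]) g
      (Finset.mem_univ g)

/-- The characteristic vector of an intersecting set of size `|G| / n` differs from `1/n` by a
single function `⟨M, P_g⟩` on all of `G`. The ratio bound on `K` provides a matrix for each coset of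
`K`; evaluating the correlation of two cosets over the derangements that map one to the other
shows that the inner product of any two of these matrices equals their squared norms, so they
coincide. -/
lemma exists_pairing_of_card_eq [K.Normal]
    (hK : IsMultiplyPretransitive K X 2)
    (hleast : IsLeast (derangementEigenvalues K X) (ratioValue K X))
    (hunique : ∀ φ : K → ℂ, IsIrreducibleCharacter K φ →
      (charEigenvalue K X φ = (ratioValue K X : ℂ) ↔ φ = psi K X))
    {S : Finset G} (hS : IsIntersecting G X S)
    (hcard : Fintype.card X * S.card = Fintype.card G) :
    ∃ M : X → X → ℝ, ZeroSums M ∧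
      ∀ g, (if g ∈ S then 1 else 0) - 1 / (Fintype.card X : ℝ) = pairing M g := by
  have hn : 1 < Fintype.card X := Fintype.one_lt_card
  have hn' : (0 : ℝ) < (Fintype.card X : ℝ) - 1 := by rw [sub_pos]; exact_mod_cast hn
  have hX : (0 : ℝ) < Fintype.card X := by linarith
  have hKpos : (0 : ℝ) < Fintype.card K := by exact_mod_cast Fintype.card_pos
  let v : G → ℝ := fun g => if g ∈ S then 1 else 0
  let f : G → ℝ := fun g => v g - 1 / Fintype.card X
  have hcoset : ∀ g : G, ∑ k : K, v (g * k) = Fintype.card K / Fintype.card X := by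
    intro g
    rw [eq_div_iff hX.ne', ← (card_le_and_card_coset K hK hleast hunique hS).2 hcard g]
    simp [v, mul_comm]
  have hlocal : ∀ g : G, ∃ N : X → X → ℝ, ZeroSums N ∧
      ∀ k : K, f (g * k) = pairing N (g * (k : G)) := by
    intro g
    obtain ⟨M, hM, h⟩ := (card_le_and_exists_pairing_of_isIntersecting hK hleast hunique
      (isIntersecting_filter_mul_mem K hS g)).2 (by
        exact_mod_cast (card_le_and_card_coset K hK hleast hunique hS).2 hcard g)
    refine ⟨fun i j => M i (g⁻¹ • j), hM.smul_right g⁻¹, fun k => ?_⟩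
    have := h k
    simp only [Finset.mem_filter, Finset.mem_univ, true_and] at this
    simp only [f, v, this, pairing, mul_smul, inv_smul_smul]
    rfl
  choose N hN hfN using hlocal
  have hrestrict : ∀ (M : X → X → ℝ) (k : K), pairing M (k : G) = pairing M k := fun _ _ => rfl
  -- squared norms
  have hnorm : ∀ g, ∑ i, ∑ j, N g i j * N g i j =
      ((Fintype.card X : ℝ) - 1) ^ 2 / (Fintype.card X : ℝ) ^ 2 := by
    intro g
    have e := sum_pairing_mul_pairing hK ((hN g).smul_right g) (fun i j => N g i (g • j))
    have e1 : ∀ k : K, pairing (fun i j => N g i (g • j)) k = f (g * k) := by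
      intro k
      rw [hfN]
      simp only [pairing, mul_smul]
      rfl
    have e2 : ∀ k : K, f (g * k) * f (g * k) =
        (1 - 2 / (Fintype.card X : ℝ)) * v (g * k) + 1 / (Fintype.card X : ℝ) ^ 2 := by
      intro k
      simp only [f, v]
      split_ifs <;> ring
    have e3 : ∀ i, ∑ j, N g i (g • j) * N g i (g • j) = ∑ j, N g i j * N g i j := fun i =>
      Equiv.sum_comp (MulAction.toPerm g) (fun j => N g i j * N g i j)
    simp only [e1, e2, e3, Finset.sum_add_distrib, ← Finset.mul_sum, hcoset, Finset.sum_const,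
      Finset.card_univ, nsmul_eq_mul] at e
    apply mul_left_cancel₀ hKpos.ne'
    rw [← e]
    field_simp
    ring
  have hinner : ∀ g, ∑ i, ∑ j, N 1 i j * N g i j =
      ((Fintype.card X : ℝ) - 1) ^ 2 / (Fintype.card X : ℝ) ^ 2 := by
    intro g
    let D : Finset G := Finset.univ.filter fun d => g⁻¹ * d ∈ K ∧ ∀ x : X, d • x ≠ x
    have hD : ∀ d ∈ D, ∀ x : X, d • x ≠ x := fun d hd => (Finset.mem_filter.mp hd).2.2
    have hDpos : (0 : ℝ) < D.card := by
      obtain ⟨k, hk⟩ := exists_forall_apply_smul_ne hK (MulAction.toPerm g)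
      refine Nat.cast_pos.mpr (Finset.card_pos.mpr ⟨g * k, ?_⟩)
      refine Finset.mem_filter.mpr ⟨Finset.mem_univ _, by simp, fun x => ?_⟩
      rw [mul_smul]
      exact hk x
    have htr : ∀ i i' j j' : X, i ≠ i' → j ≠ j' →
        ∃ t : G, t • i = j ∧ t • i' = j' ∧ ∀ d ∈ D, t * d * t⁻¹ ∈ D := by
      intro i i' j j' hi hj
      obtain ⟨t, h, h'⟩ := is_two_pretransitive_iff.mp hK hi hj
      refine ⟨t, h, h', fun d hd => ?_⟩
      obtain ⟨-, hd1, hd2⟩ := Finset.mem_filter.mp hd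
      refine Finset.mem_filter.mpr ⟨Finset.mem_univ _, ?_, fun x hx => hd2 ((t : G)⁻¹ • x) ?_⟩
      · have h1 : g⁻¹ * t * g⁻¹⁻¹ ∈ K := ‹K.Normal›.conj_mem t t.2 g⁻¹
        have h2 := K.mul_mem (K.mul_mem h1 hd1) (K.inv_mem t.2)
        convert h2 using 1
        group
      · rw [eq_inv_smul_iff, ← mul_smul, ← mul_smul]
        exact hx
    -- the correlation of `f` with its translates by `D`, computed from independence of `S`
    have hcorr : ∀ d ∈ D, ∑ x : K, f x * f (x * d) =
        -(Fintype.card K : ℝ) / (Fintype.card X : ℝ) ^ 2 := by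
      intro d hd
      have h0 : ∀ x : K, v x * v (x * d) = 0 := by
        intro x
        by_contra hne
        have hx : (x : G) ∈ S ∧ (x : G) * d ∈ S := by
          simpa [v, and_comm] using hne
        obtain ⟨l, hl⟩ := hS _ hx.1 _ hx.2
        rw [mul_smul] at hl
        exact hD d hd l (smul_left_cancel (x : G) hl).symm
      have h1 : ∑ x : K, v x = Fintype.card K / Fintype.card X := by
        simpa using hcoset 1
      have h2 : ∑ x : K, v (x * d) = Fintype.card K / Fintype.card X := by
        refine Eq.trans ?_ ((Equiv.sum_comp (MulAut.conjNormal d⁻¹ : MulAut K).toEquiv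
          fun k => v (d * k)).trans (hcoset d))
        refine Finset.sum_congr rfl fun x _ => ?_
        congr 1
        simp [mul_assoc]
      have h3 : ∀ x : K, f x * f (x * d) = -(1 / (Fintype.card X : ℝ)) * v x -
          1 / (Fintype.card X : ℝ) * v (x * d) + 1 / (Fintype.card X : ℝ) ^ 2 := by
        intro x
        simp only [f]
        linear_combination h0 x
      simp only [h3, Finset.sum_add_distrib, Finset.sum_sub_distrib, ← Finset.mul_sum, h1, h2,
        Finset.sum_const, Finset.card_univ, nsmul_eq_mul]
      field_simp
      ring
    -- the same correlation, computed from the matrices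
    have hmat : ∀ x : K, ((Fintype.card X : ℝ) - 1) * ∑ d ∈ D, f x * f (x * d) =
        -(D.card : ℝ) * (pairing (N 1) x * pairing (N g) x) := by
      intro x
      have hx1 : f x = pairing (N 1) x := by
        have := hfN 1 x
        rw [one_mul] at this
        exact this
      have hxd : ∀ d ∈ D, f (x * d) = pairing (N g) (x * d) := by
        intro d hd
        have h1 : g⁻¹ * x * g⁻¹⁻¹ ∈ K := ‹K.Normal›.conj_mem x x.2 g⁻¹
        have h2 := K.mul_mem h1 (Finset.mem_filter.mp hd).2.1
        have := hfN g ⟨_, h2⟩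
        have hg : g * (g⁻¹ * x * g⁻¹⁻¹ * (g⁻¹ * d)) = x * d := by group
        simpa only [hg] using this
      rw [← Finset.mul_sum, Finset.sum_congr rfl hxd, hx1, ← hrestrict (N g)]
      linear_combination pairing (N 1) x * sum_pairing_mul_derangements hD htr (hN g) (x : G)
    have e := sum_pairing_mul_pairing hK (hN 1) (N g)
    have e' : ((Fintype.card X : ℝ) - 1) * (D.card * (-(Fintype.card K : ℝ) /
        (Fintype.card X : ℝ) ^ 2)) = -(D.card : ℝ) * ∑ x : K, pairing (N 1) x * pairing (N g) x := by
      rw [Finset.mul_sum, ← Finset.sum_congr rfl fun x _ => hmat x, ← Finset.mul_sum,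
        Finset.sum_comm, Finset.sum_congr rfl hcorr, Finset.sum_const, nsmul_eq_mul]
    apply mul_left_cancel₀ (mul_pos hKpos hDpos).ne'
    have e'' : (D.card : ℝ) * ∑ x : K, pairing (N 1) x * pairing (N g) x =
      ((Fintype.card X : ℝ) - 1) * (D.card * ((Fintype.card K : ℝ) /
        (Fintype.card X : ℝ) ^ 2)) := by
      linear_combination e'
    rw [mul_assoc, mul_left_comm, ← e, mul_left_comm, e'']
    field_simp
  refine ⟨N 1, hN 1, fun g => ?_⟩
  -- equality in the Cauchy-Schwarz inequality
  have hdist : ∑ i, ∑ j, (N 1 i j - N g i j) ^ 2 = 0 := by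
    have : ∀ i j, (N 1 i j - N g i j) ^ 2 =
        N 1 i j * N 1 i j - 2 * (N 1 i j * N g i j) + N g i j * N g i j := fun i j => by ring
    simp only [this, Finset.sum_add_distrib, Finset.sum_sub_distrib, ← Finset.mul_sum, hnorm,
      hinner]
    ring
  have heq : N 1 = N g := by
    funext i j
    have h1 := (Finset.sum_eq_zero_iff_of_nonneg fun i _ =>
      Finset.sum_nonneg fun j _ => sq_nonneg _).mp hdist i (Finset.mem_univ i)
    have h2 := (Finset.sum_eq_zero_iff_of_nonneg fun j _ => sq_nonneg _).mp h1 j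
      (Finset.mem_univ j)
    exact sub_eq_zero.mp (pow_eq_zero_iff (by norm_num) |>.mp h2)
  have := hfN g 1
  simp only [OneMemClass.coe_one, mul_one] at this
  rw [heq]
  exact this

end Gluing

/-! ### The module of `ψ` -/

section Module

variable {G X : Type*} [Group G] [Fintype G] [Fintype X] [MulAction G X]

lemma psi_one {G X : Type*} [Group G] [Fintype X] [MulAction G X] :
    psi G X 1 = Fintype.card X - 1 := by
  have : fixedBy X (1 : G) = Set.univ := by ext; simp
  rw [psi, permChar, this, Nat.card_univ, Nat.card_eq_fintype_card]

/-- The matrix `E_ψ` fixes the functions `⟨M, P_g⟩`. -/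
lemma pairing_mem_charModule [Nontrivial X] (hG : IsMultiplyPretransitive G X 2)
    {M : X → X → ℂ} (hM : ZeroSums M) : pairing M ∈ charModule G (psi G X) := by
  have hp : IsPretransitive G X := isPretransitive_of_is_two_pretransitive
  have hcardG : (Fintype.card G : ℂ) ≠ 0 := by simp
  refine ⟨pairing M, ?_⟩
  funext g
  have : (idempotentMatrix G (psi G X)).mulVec (pairing M) g =
      psi G X 1 / Fintype.card G * ∑ h, psi G X (h * g⁻¹) * pairing M h := by
    simp only [Matrix.mulVec, dotProduct, idempotentMatrix, Matrix.of_apply, mul_assoc,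
      Finset.mul_sum]
  rw [Matrix.mulVecLin_apply, this, sum_psi_mul, sum_pairing_eq_zero hM, psi_one, sub_zero,
    div_mul_eq_mul_div, Finset.mul_sum,
    Finset.sum_congr rfl fun l _ => sum_filter_pairing hG hM l (g • l), ← Finset.mul_sum,
    mul_div_cancel_left₀ _ hcardG]
  rfl

lemma pairing_mem_span {G X : Type*} [Group G] [Fintype X] [MulAction G X] (M : X → X → ℂ) :
    (pairing M : G → ℂ) ∈
      Submodule.span ℂ {v : G → ℂ | ∃ i j : X, v = charVec (canonicalSet G i j)} := by
  have : (pairing M : G → ℂ) = ∑ i, ∑ j, M i j • charVec (canonicalSet G i j) := by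
    funext g
    simp [pairing, charVec, canonicalSet, Finset.sum_apply]
  rw [this]
  exact Submodule.sum_mem _ fun i _ => Submodule.sum_mem _ fun j _ =>
    Submodule.smul_mem _ _ (Submodule.subset_span ⟨i, j, rfl⟩)

lemma isIndepSet_iff_isIntersecting {G X : Type*} [Group G] [MulAction G X] [Nonempty X]
    (S : Finset G) :
    (derangementGraph G X).IsIndepSet S ↔ IsIntersecting G X S := by
  constructor
  · intro h a ha b hb
    by_cases hab : a = b
    · obtain ⟨x⟩ := ‹Nonempty X›
      exact ⟨x, by rw [hab]⟩
    · by_contra hno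
      exact h ha hb hab ⟨hab, hno⟩
  · intro h a ha b hb _ hadj
    exact hadj.2 (h a ha b hb)

/-- The matrix of a maximum intersecting set, over the complex numbers. -/
lemma exists_charVec_sub_eq_pairing [Nontrivial X] (hG : IsMultiplyPretransitive G X 2)
    (K : Subgroup G) [Fintype K] [K.Normal] (hK : IsMultiplyPretransitive K X 2)
    (hleast : IsLeast (derangementEigenvalues K X) (ratioValue K X))
    (hunique : ∀ φ : K → ℂ, IsIrreducibleCharacter K φ →
      (charEigenvalue K X φ = (ratioValue K X : ℂ) ↔ φ = psi K X))
    {S : Finset G} (hS : IsIntersecting G X S)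
    (hmax : ∀ T : Finset G, IsIntersecting G X T → T.card ≤ S.card) :
    ∃ M : X → X → ℂ, ZeroSums M ∧
      (charVec (S : Set G) - fun _ => 1 / (Fintype.card X : ℂ)) = pairing M := by
  have hp : IsPretransitive G X := isPretransitive_of_is_two_pretransitive
  obtain ⟨x⟩ := (inferInstance : Nonempty X)
  -- a point stabilizer is an intersecting set of size `|G| / n`
  have hcard : Fintype.card X * S.card = Fintype.card G := by
    refine le_antisymm (card_le_and_card_coset K hK hleast hunique hS).1 ?_
    rw [← card_mul_card_filter_smul_eq (H := G) x x]
    refine Nat.mul_le_mul_left _ (hmax _ fun a ha b hb => ⟨x, ?_⟩)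
    rw [(Finset.mem_filter.mp ha).2, (Finset.mem_filter.mp hb).2]
  obtain ⟨M, hM, h⟩ := exists_pairing_of_card_eq K hK hleast hunique hS hcard
  refine ⟨fun i j => (M i j : ℂ), ⟨fun i => ?_, fun j => ?_⟩, ?_⟩
  · exact_mod_cast hM.row i
  · exact_mod_cast hM.col j
  · funext g
    have := congrArg (fun r : ℝ => (r : ℂ)) (h g)
    simp only [pairing, Complex.ofReal_sum] at this
    rw [pairing, ← this]
    simp only [Pi.sub_apply, charVec, Finset.mem_coe]
    split_ifs <;> push_cast <;> rfl

end Module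

end

end EKR

theorem mainTheorem2 {G X : Type*} [Group G] [Fintype G] [Fintype X] [MulAction G X]
    [FaithfulSMul G X]
    -- `G` is 2-transitive on `X`
    (hG : MulAction.IsMultiplyPretransitive G X 2)
    (K : Subgroup G) [Fintype K]
    -- `K` is minimal among the nonabelian normal subgroups of `G`
    (hKmin : Minimal (fun H : Subgroup G => H.Normal ∧ ¬ IsMulCommutative H) K)
    -- `K` is 2-transitive on `X`
    (hK : MulAction.IsMultiplyPretransitive K X 2)
    -- `-d_K / (n - 1)` is the least eigenvalue of `Γ_K`
    (hleast : IsLeast (EKR.derangementEigenvalues K X) (EKR.ratioValue K X))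
    -- `ψ_K` is the only irreducible character of `K` affording it
    (hunique : ∀ φ : K → ℂ, EKR.IsIrreducibleCharacter K φ →
      (EKR.charEigenvalue K X φ = (EKR.ratioValue K X : ℂ) ↔ φ = EKR.psi K X)) :
    (∀ S : Finset G, (EKR.derangementGraph G X).IsMaximumIndepSet S →
      (EKR.charVec (S : Set G) - fun _ => 1 / (Fintype.card X : ℂ)) ∈
        EKR.charModule G (EKR.psi G X)) ∧
    EKR.HasEKRModuleProperty G X := by
  classical
  obtain ⟨hnormal, hcomm⟩ := hKmin.prop
  -- a group acting faithfully on at most one point is trivial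
  have hX : Nontrivial X := by
    by_contra h
    rw [not_nontrivial_iff_subsingleton] at h
    refine hcomm ⟨⟨fun a b => Subtype.ext ?_⟩⟩
    exact FaithfulSMul.eq_of_smul_eq_smul (α := X) fun x => Subsingleton.elim _ _
  constructor
  · intro S hS
    obtain ⟨M, hM, h⟩ := EKR.exists_charVec_sub_eq_pairing hG K hK hleast hunique
      ((EKR.isIndepSet_iff_isIntersecting S).mp hS.1)
      fun T hT => hS.2 T ((EKR.isIndepSet_iff_isIntersecting T).mpr hT)
    rw [h]
    exact EKR.pairing_mem_charModule hG hM
  · intro S hS hmax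
    obtain ⟨M, hM, h⟩ := EKR.exists_charVec_sub_eq_pairing hG K hK hleast hunique hS hmax
    obtain ⟨x⟩ := (inferInstance : Nonempty X)
    -- the constant function `1/n` is itself of the form `⟨M, P_g⟩`
    rw [sub_eq_iff_eq_add.mp h]
    refine Submodule.add_mem _ (EKR.pairing_mem_span M) ?_
    convert EKR.pairing_mem_span (G := G) (X := X)
      (fun i _ => if i = x then 1 / (Fintype.card X : ℂ) else 0) using 1
    funext g
    simp [EKR.pairing]
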